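/- Let $d\ge 2$ and let $\mathbb S^d=\{x\in\mathbb R^{d+1}:|x|=1\}$ be the round sphere, with Laplace–Beltrami operator $\Delta$. Let $N(z)$ be the number of eigenvalues, counted with multiplicity, of $-\Delta u=\lambda u$ on $\mathbb S^d$ that are at most $z$. Let $L^{class}_{\gamma,d}=(4\pi)^{-d/2}\,\Gamma(\gamma+1)/\Gamma(\gamma+1+\tfrac d2)$ and $\psi(\eta)=\eta-\lfloor\eta\rfloor-\tfrac12$ for $\eta\ge0$; let $|\mathbb S^d|$ be the $d$-dimensional measure of the sphere and $|\partial\mathbb S^d_+|$ the $(d-1)$-dimensional measure of the boundary of the hemisphere $\mathbb S^d_+=\mathbb S^d\cap\{x_{d+1}>0\}$. For $z\ge 0$ let $w=w(z)\ge0$ be defined by $w(w+d-1)=z$. Then $N(z)$ is finite for every $z$, and as $z\to+\infty$ $$\frac{N(z)}{L^{class}_{0,d}|\mathbb S^d|z^{\frac d2}}=1-\frac{L^{class}_{0,d-1}}{L^{class}_{0,d}}\frac{|\partial\mathbb S^d_+|}{|\mathbb S^d|}\,\psi(w)\,z^{-\frac12}+\frac{d(d-1)\left(12\psi^2(w)+2d-1\right)}{24}\,z^{-1}+O\!\left(z^{-\frac32}\right),$$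 where the constant in the remainder may depend on $d$. -/

import Mathlib

open scoped Manifold ContDiff Laplacian ENNReal

/-- The ambient Euclidean space `ℝ^{d+1}`. -/
abbrev Ambient (d : ℕ) : Type := EuclideanSpace ℝ (Fin (d + 1))

/-- The unit sphere `S^d = {x ∈ ℝ^{d+1} : |x| = 1}`. -/
abbrev UnitSphere (d : ℕ) : Type := Metric.sphere (0 : Ambient d) 1

/-- The extension of a function `f` on `S^d` to a function on `ℝ^{d+1} ∖ {0}` that is constant along
rays, `y ↦ f (y / |y|)`. (The value at the origin is irrelevant.) -/
noncomputable def radialExtension {d : ℕ} (f : UnitSphere d → ℝ) (y : Ambient d) : ℝ :=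
  if h : y = 0 then 0
  else f ⟨‖y‖⁻¹ • y, by simp [norm_smul, norm_ne_zero_iff.mpr h]⟩

/-- The Laplace-Beltrami operator `Δ` of the round sphere `S^d`, with the sign convention of
analysts (`Δ ≤ 0`): `(Δ f)(x)` is the Euclidean Laplacian at `x ∈ S^d` of `y ↦ f (y / |y|)`.
Indeed, the second derivative of that function at `x` vanishes in the radial direction `x`, and in a
unit tangent direction `e ⊥ x` it is the second derivative at `t = 0` of `f` along the unit-speed
geodesic `t ↦ cos t • x + sin t • e`; so this is the trace of the Riemannian Hessian of `f`. -/
noncomputable def laplaceBeltrami {d : ℕ} (f : UnitSphere d → ℝ) (x : UnitSphere d) : ℝ :=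
  Δ (radialExtension f) (x : Ambient d)

lemma contDiffAt_radialExtension {d : ℕ} {f : UnitSphere d → ℝ}
    (hf : ContMDiff (𝓡 d) 𝓘(ℝ, ℝ) ∞ f) {y : Ambient d} (hy : y ≠ 0) :
    ContDiffAt ℝ ∞ (radialExtension f) y := by
  have := Fact.mk (@finrank_euclideanSpace_fin ℝ _ (d + 1))
  let U : TopologicalSpace.Opens (Ambient d) := ⟨{0}ᶜ, isOpen_compl_singleton⟩
  have hU : ∀ u : U, (u : Ambient d) ≠ 0 := fun u => u.2
  let g : U → Ambient d := fun u => ‖(u : Ambient d)‖⁻¹ • (u : Ambient d)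
  have hg : ContMDiff 𝓘(ℝ, Ambient d) 𝓘(ℝ, Ambient d) ∞ g := by
    intro u
    have h : ContDiffAt ℝ ∞ (fun z : Ambient d => ‖z‖⁻¹ • z) (u : Ambient d) :=
      ((contDiffAt_norm ℝ (hU u)).inv (norm_ne_zero_iff.mpr (hU u))).smul contDiffAt_id
    exact contMDiffAt_subtype_iff.mpr h.contMDiffAt
  have hgs : ∀ u : U, g u ∈ Metric.sphere (0 : Ambient d) 1 := fun u => by
    simp [g, norm_smul, norm_ne_zero_iff.mpr (hU u)]
  have h1 : ContMDiff 𝓘(ℝ, Ambient d) 𝓘(ℝ, ℝ) ∞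
      (fun u : U => f (Set.codRestrict g _ hgs u)) :=
    hf.comp (hg.codRestrict_sphere hgs)
  have h2 : (fun u : U => f (Set.codRestrict g _ hgs u)) =
      fun u : U => radialExtension f (u : Ambient d) := by
    funext u
    simp only [radialExtension, dif_neg (hU u)]
    rfl
  rw [h2] at h1
  exact contMDiffAt_iff_contDiffAt.mp
    (contMDiffAt_subtype_iff (x := (⟨y, hy⟩ : U)).mp (h1 ⟨y, hy⟩))

lemma radialExtension_add {d : ℕ} (f g : UnitSphere d → ℝ) :
    radialExtension (f + g) = radialExtension f + radialExtension g := by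
  funext y
  by_cases h : y = 0 <;> simp [radialExtension, h]

lemma radialExtension_smul {d : ℕ} (c : ℝ) (f : UnitSphere d → ℝ) :
    radialExtension (c • f) = c • radialExtension f := by
  funext y
  by_cases h : y = 0 <;> simp [radialExtension, h]

lemma contDiffAt_two_radialExtension {d : ℕ} {f : UnitSphere d → ℝ}
    (hf : ContMDiff (𝓡 d) 𝓘(ℝ, ℝ) ∞ f) (x : UnitSphere d) :
    ContDiffAt ℝ 2 (radialExtension f) (x : Ambient d) :=
  (contDiffAt_radialExtension hf (ne_zero_of_mem_unit_sphere x)).of_le (by norm_cast)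

/-- The space of (smooth) solutions `f` on `S^d` of `-Δ f = μ f`: the eigenspace of `-Δ` at `μ` if
`μ` is an eigenvalue, and `{0}` otherwise. -/
noncomputable def laplaceEigenspace (d : ℕ) (μ : ℝ) : Submodule ℝ (UnitSphere d → ℝ) where
  carrier := {f | ContMDiff (𝓡 d) 𝓘(ℝ, ℝ) ∞ f ∧ ∀ x, -laplaceBeltrami f x = μ * f x}
  zero_mem' := by
    refine ⟨contMDiff_const, fun x => ?_⟩
    have h : radialExtension (0 : UnitSphere d → ℝ) = fun _ => 0 := by
      funext y
      simp [radialExtension]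
    simp [laplaceBeltrami, h]
  add_mem' := by
    rintro f g ⟨hf, hf'⟩ ⟨hg, hg'⟩
    refine ⟨hf.add hg, fun x => ?_⟩
    have := (contDiffAt_two_radialExtension hf x).laplacian_add
      (contDiffAt_two_radialExtension hg x)
    have h1 := hf' x
    have h2 := hg' x
    simp only [laplaceBeltrami, radialExtension_add, this, Pi.add_apply] at h1 h2 ⊢
    linarith
  smul_mem' := by
    rintro c f ⟨hf, hf'⟩
    refine ⟨contMDiff_const.mul hf, fun x => ?_⟩
    have := InnerProductSpace.laplacian_smul c (contDiffAt_two_radialExtension hf x)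
    have h1 := hf' x
    simp only [laplaceBeltrami, radialExtension_smul, this, Pi.smul_apply, smul_eq_mul] at h1 ⊢
    linear_combination c * h1

/-- The multiplicity of `μ` as an eigenvalue of `-Δ` on `S^d` (zero if `μ` is not an eigenvalue). -/
noncomputable def laplaceMultiplicity (d : ℕ) (μ : ℝ) : ℕ∞ :=
  Cardinal.toENat (Module.rank ℝ (laplaceEigenspace d μ))

/-- The counting function `N(z)` of the Laplacian on `S^d`: the number, with multiplicity, of the
eigenvalues of `-Δ` that are at most `z`. A priori it may be infinite. -/
noncomputable def sphereCounting (d : ℕ) (z : ℝ) : ℝ≥0∞ :=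
  ∑' μ : Set.Iic z, (laplaceMultiplicity d μ : ℝ≥0∞)

/-- The semiclassical constant `L^class_{γ,d}`. -/
noncomputable def semiclassicalConst (γ d : ℝ) : ℝ :=
  (4 * Real.pi) ^ (-d / 2) * (Real.Gamma (γ + 1) / Real.Gamma (γ + 1 + d / 2))

/-- The fluctuation function `ψ`. -/
noncomputable def fluctuation (η : ℝ) : ℝ := η - ⌊η⌋ - 1 / 2

/-- The surface measure `|S^d|` of the sphere. -/
noncomputable def sphereArea (d : ℕ) : ℝ :=
  (MeasureTheory.volume : MeasureTheory.Measure (Ambient d)).toSphere.real Set.univ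

/-- The hemisphere `S^d_+ = S^d ∩ {x_{d+1} > 0}`. -/
def hemisphere (d : ℕ) : Set (UnitSphere d) := {x | 0 < (x : Ambient d) (Fin.last d)}

/-- The hyperplane `{x_{d+1} = 0}`, a Euclidean space of dimension `d`. -/
noncomputable def equatorialHyperplane (d : ℕ) : Submodule ℝ (Ambient d) :=
  LinearMap.ker ((EuclideanSpace.proj (Fin.last d) : Ambient d →L[ℝ] ℝ) : Ambient d →ₗ[ℝ] ℝ)

/-- The inclusion into `S^d` of the equator, the unit sphere of the hyperplane `{x_{d+1} = 0}`. -/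
def equatorInclusion (d : ℕ) (x : Metric.sphere (0 : equatorialHyperplane d) 1) : UnitSphere d :=
  ⟨((x : equatorialHyperplane d) : Ambient d), mem_sphere_zero_iff_norm.mpr
    ((Submodule.coe_norm _).symm.trans (norm_eq_of_mem_sphere x))⟩

lemma frontier_hemisphere (d : ℕ) :
    frontier (hemisphere d) = Set.range (equatorInclusion d) := by
  have hc : Continuous fun x : UnitSphere d => (x : Ambient d) (Fin.last d) := by fun_prop
  have hr : Set.range (equatorInclusion d) =
      {x : UnitSphere d | (x : Ambient d) (Fin.last d) = 0} := by
    ext x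
    constructor
    · rintro ⟨y, rfl⟩
      exact (y : equatorialHyperplane d).2
    · intro hx
      exact ⟨⟨⟨(x : Ambient d), hx⟩, mem_sphere_zero_iff_norm.mpr (norm_eq_of_mem_sphere x)⟩, rfl⟩
  rw [hr]
  apply Set.Subset.antisymm
  · intro x hx
    exact (frontier_lt_subset_eq continuous_const hc hx).symm
  · intro x hx
    have hx : (x : Ambient d) (Fin.last d) = 0 := hx
    have ho : IsOpen (hemisphere d) := isOpen_lt continuous_const hc
    rw [ho.frontier_eq]
    refine ⟨?_, fun h => (show 0 < (x : Ambient d) (Fin.last d) from h).ne' hx⟩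
    let e : Ambient d := EuclideanSpace.single (Fin.last d) 1
    let v : ℝ → Ambient d := fun t => Real.cos t • (x : Ambient d) + Real.sin t • e
    have hv : ∀ t, v t ∈ Metric.sphere (0 : Ambient d) 1 := fun t => by
      rw [mem_sphere_zero_iff_norm, ← sq_eq_sq₀ (norm_nonneg _) zero_le_one, norm_add_sq_real,
        inner_smul_left, inner_smul_right]
      have h1 : inner ℝ (x : Ambient d) e = 0 := by
        simp [e, EuclideanSpace.inner_single_right, hx]
      have h2 : ‖(x : Ambient d)‖ = 1 := norm_eq_of_mem_sphere x
      simp [h1, h2, norm_smul, e]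
    have hvc : Continuous fun t => (⟨v t, hv t⟩ : UnitSphere d) := by
      refine Continuous.subtype_mk ?_ _
      fun_prop
    have hlim : Filter.Tendsto (fun t => (⟨v t, hv t⟩ : UnitSphere d)) (nhdsWithin 0 (Set.Ioi 0))
        (nhds x) := by
      have h0 : (⟨v 0, hv 0⟩ : UnitSphere d) = x := Subtype.ext (by simp [v])
      have := hvc.tendsto 0
      rw [h0] at this
      exact this.mono_left nhdsWithin_le_nhds
    refine mem_closure_of_tendsto hlim ?_
    filter_upwards [Ioo_mem_nhdsGT Real.pi_pos] with t ht
    have : 0 < Real.sin t := Real.sin_pos_of_pos_of_lt_pi ht.1 ht.2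
    simpa [hemisphere, v, e, hx] using this

/-- The `(d-1)`-dimensional measure `|∂S^d_+|` of the boundary of the hemisphere. The boundary is
the equator, which is measured by its surface measure as the unit sphere of `{x_{d+1} = 0}`. -/
noncomputable def hemisphereBoundaryArea (d : ℕ) : ℝ :=
  (MeasureTheory.volume : MeasureTheory.Measure (equatorialHyperplane d)).toSphere.real
    (equatorInclusion d ⁻¹' frontier (hemisphere d))

/-! The spectrum of `-Δ` on the sphere is explicit: the eigenvalues are `k(k+d-1)`, `k ≥ 0`, with
the degree-`k` spherical harmonics as eigenspaces. Hence `N(z)` counts harmonics of degree at most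
`K = ⌊w⌋`, and the asymptotics are those of a polynomial in `K`.

Dimensions come from the Fischer decomposition (`fischerSpan_eq`): the Laplacian maps homogeneous
polynomials of degree `k+2` onto those of degree `k`, so the sum of dimensions telescopes to two
binomials (`sum_finrank_harmonicPoly`). That nothing else is in the spectrum follows from
orthogonality of eigenfunctions (`integral_radialWeight_mul_eq_zero`) and completeness of the
harmonics (`eq_zero_of_forall_harmonicPoly`). Integrals over the sphere are replaced by integrals
over an annulus of degree-zero extensions, so that only Euclidean integration by parts is needed.

With `d = n+1`, `d! N = (2K+d)(K+1)⋯(K+n)`, while the Weyl constant times the area is `2/d!`. So the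
quotient is a product of `d` factors `(K+a) z^{-1/2}`. Since `(w+(d-1)/2)² = z+((d-1)/2)²`, each
factor has an expansion to second order in `z^{-1/2}` (`hasQuadraticExpansion_floor_add`);
multiplying them gives the theorem. -/

namespace MvPolynomial

/-! ### Harmonic polynomials: Fischer decomposition and dimensions. -/

variable {σ : Type*} [Fintype σ]

/-- The formal Laplacian `∑ᵢ ∂ᵢ²` on polynomials. -/
noncomputable def polyLaplacian (σ : Type*) [Fintype σ] :
    MvPolynomial σ ℝ →ₗ[ℝ] MvPolynomial σ ℝ :=
  ∑ i, (pderiv i).toLinearMap ∘ₗ (pderiv i).toLinearMap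

/-- The polynomial `∑ᵢ xᵢ²`. -/
noncomputable def normSqPoly (σ : Type*) [Fintype σ] : MvPolynomial σ ℝ := ∑ i, X i ^ 2

lemma polyLaplacian_apply (p : MvPolynomial σ ℝ) :
    polyLaplacian σ p = ∑ i, pderiv i (pderiv i p) := by
  simp [polyLaplacian]

lemma isHomogeneous_normSqPoly : (normSqPoly σ).IsHomogeneous 2 :=
  IsHomogeneous.sum _ _ _ fun i _ => isHomogeneous_X_pow i 2

lemma pderiv_normSqPoly (i : σ) : pderiv i (normSqPoly σ) = 2 * X i := by
  classical
  simp [normSqPoly, Derivation.leibniz_pow, pderiv_X, Pi.single_apply]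

/-- In the product rule `Δ|x|²` contributes twice the number of variables, and Euler's identity
turns the cross term `4 ∑ xᵢ ∂ᵢp` into `4m p`. -/
lemma polyLaplacian_normSqPoly_mul {p : MvPolynomial σ ℝ} {m : ℕ} (hp : p.IsHomogeneous m) :
    polyLaplacian σ (normSqPoly σ * p) = normSqPoly σ * polyLaplacian σ p +
      ((2 * Fintype.card σ + 4 * m : ℕ) : ℝ) • p := by
  have h : ∀ i : σ, pderiv i (pderiv i (normSqPoly σ * p)) =
      normSqPoly σ * pderiv i (pderiv i p) + 4 * (X i * pderiv i p) + 2 * p := fun i => by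
    have h2 : pderiv i (2 : MvPolynomial σ ℝ) = 0 := by
      exact_mod_cast Derivation.map_natCast (pderiv (R := ℝ) i) 2
    simp only [Derivation.leibniz, pderiv_normSqPoly, map_add, smul_eq_mul, h2,
      pderiv_X_self]
    ring
  simp only [polyLaplacian_apply, h, Finset.sum_add_distrib, ← Finset.mul_sum,
    hp.sum_X_mul_pderiv]
  rw [Nat.cast_smul_eq_nsmul]
  simp only [nsmul_eq_mul, Finset.sum_const, Finset.card_univ]
  push_cast
  ring

lemma IsHomogeneous.polyLaplacian {p : MvPolynomial σ ℝ} {k : ℕ} (hp : p.IsHomogeneous (k + 2)) :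
    (polyLaplacian σ p).IsHomogeneous k := by
  rw [polyLaplacian_apply]
  exact IsHomogeneous.sum _ _ _ fun i _ => hp.pderiv.pderiv

lemma IsHomogeneous.polyLaplacian_eq_zero {p : MvPolynomial σ ℝ} {k : ℕ} (hp : p.IsHomogeneous k)
    (hk : k < 2) : MvPolynomial.polyLaplacian σ p = 0 := by
  rw [polyLaplacian_apply]
  refine Finset.sum_eq_zero fun i _ => ?_
  have h : (pderiv i p).IsHomogeneous 0 := by
    have := hp.pderiv (i := i)
    rwa [show k - 1 = 0 by omega] at this
  rw [← totalDegree_zero_iff_isHomogeneous, totalDegree_eq_zero_iff_eq_C] at h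
  rw [h]; simp

/-- Homogeneous harmonic polynomials of degree `k`. -/
noncomputable def harmonicPoly (σ : Type*) [Fintype σ] (k : ℕ) :
    Submodule ℝ (MvPolynomial σ ℝ) :=
  homogeneousSubmodule σ ℝ k ⊓ LinearMap.ker (polyLaplacian σ)

/-- The span of the products `|x|^{2j} h` of degree `k`, with `h` homogeneous and harmonic. -/
noncomputable def fischerSpan (σ : Type*) [Fintype σ] (k : ℕ) :
    Submodule ℝ (MvPolynomial σ ℝ) :=
  Submodule.span ℝ {p | ∃ j m h, 2 * j + m = k ∧ h ∈ harmonicPoly σ m ∧ p = normSqPoly σ ^ j * h}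

lemma isHomogeneous_normSqPoly_pow_mul {h : MvPolynomial σ ℝ} {m : ℕ} (hh : h.IsHomogeneous m)
    (j : ℕ) : (normSqPoly σ ^ j * h).IsHomogeneous (2 * j + m) :=
  (isHomogeneous_normSqPoly.pow j).mul hh

lemma fischerSpan_le (k : ℕ) : fischerSpan σ k ≤ homogeneousSubmodule σ ℝ k := by
  refine Submodule.span_le.2 ?_
  rintro _ ⟨j, m, h, rfl, hh, rfl⟩
  exact isHomogeneous_normSqPoly_pow_mul hh.1 j

/-- Positivity of `c` allows division by it, which makes the Laplacian surjective between Fischer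
spans. -/
lemma exists_polyLaplacian_normSqPoly_pow_mul [Nonempty σ] {h : MvPolynomial σ ℝ} {m : ℕ}
    (hh : h ∈ harmonicPoly σ m) (j : ℕ) :
    ∃ c : ℝ, 0 < c ∧ polyLaplacian σ (normSqPoly σ ^ (j + 1) * h) = c • (normSqPoly σ ^ j * h) := by
  have hσ : 0 < (Fintype.card σ : ℝ) := by exact_mod_cast Fintype.card_pos
  induction j with
  | zero =>
    refine ⟨((2 * Fintype.card σ + 4 * m : ℕ) : ℝ), by push_cast; positivity, ?_⟩
    rw [zero_add, pow_one, polyLaplacian_normSqPoly_mul hh.1, LinearMap.mem_ker.1 hh.2]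
    simp
  | succ j ih =>
    obtain ⟨c, hc, h1⟩ := ih
    refine ⟨c + ((2 * Fintype.card σ + 4 * (2 * (j + 1) + m) : ℕ) : ℝ), by positivity, ?_⟩
    rw [pow_succ' _ (j + 1), mul_assoc,
      polyLaplacian_normSqPoly_mul (isHomogeneous_normSqPoly_pow_mul hh.1 (j + 1)), h1, add_smul]
    congr 1
    rw [mul_smul_comm, pow_succ' _ j, mul_assoc]

lemma exists_polyLaplacian_eq_of_mem_fischerSpan [Nonempty σ] {k : ℕ} {q : MvPolynomial σ ℝ}
    (hq : q ∈ fischerSpan σ k) : ∃ u ∈ fischerSpan σ (k + 2), polyLaplacian σ u = q := by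
  suffices h : fischerSpan σ k ≤ (fischerSpan σ (k + 2)).map (polyLaplacian σ) from h hq
  refine Submodule.span_le.2 ?_
  rintro _ ⟨j, m, h, rfl, hh, rfl⟩
  obtain ⟨c, hc, h1⟩ := exists_polyLaplacian_normSqPoly_pow_mul hh j
  refine ⟨c⁻¹ • (normSqPoly σ ^ (j + 1) * h), Submodule.smul_mem _ _ (Submodule.subset_span
    ⟨j + 1, m, h, by ring, hh, rfl⟩), ?_⟩
  rw [map_smul, h1, smul_smul, inv_mul_cancel₀ hc.ne', one_smul]

/-- **Fischer decomposition**. -/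
theorem fischerSpan_eq [Nonempty σ] (k : ℕ) : fischerSpan σ k = homogeneousSubmodule σ ℝ k := by
  refine le_antisymm (fischerSpan_le k) ?_
  induction k using Nat.strong_induction_on with
  | _ k ih =>
    intro p hp
    have hharm : ∀ u : MvPolynomial σ ℝ, u ∈ harmonicPoly σ k → u ∈ fischerSpan σ k := fun u hu =>
      Submodule.subset_span ⟨0, k, u, by ring, hu, by simp⟩
    rcases lt_or_ge k 2 with hk | hk
    · exact hharm p ⟨hp, IsHomogeneous.polyLaplacian_eq_zero hp hk⟩
    · obtain ⟨k, rfl⟩ := Nat.exists_eq_add_of_le' hk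
      -- Here `Δu = Δp` with `u` in the span, so `p - u` is harmonic.
      obtain ⟨u, hu, hup⟩ := exists_polyLaplacian_eq_of_mem_fischerSpan
        (ih k (by omega) (IsHomogeneous.polyLaplacian hp))
      rw [← sub_add_cancel p u]
      refine Submodule.add_mem _ (hharm _ ⟨Submodule.sub_mem _ hp (fischerSpan_le _ hu), ?_⟩) hu
      simp [hup]

instance (k : ℕ) : Module.Finite ℝ (homogeneousSubmodule σ ℝ k) :=
  Module.Finite.iff_fg.2 (homogeneousSubmodule_fg σ ℝ k)

instance (k : ℕ) : Module.Finite ℝ (harmonicPoly σ k) :=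
  Submodule.finiteDimensional_inf_left _ _

/-- Rank–nullity for the Laplacian from degree `k+2` to degree `k`, which is onto by the Fischer
decomposition. -/
lemma finrank_harmonicPoly_add [Nonempty σ] (k : ℕ) :
    Module.finrank ℝ (harmonicPoly σ (k + 2)) + Module.finrank ℝ (homogeneousSubmodule σ ℝ k) =
      Module.finrank ℝ (homogeneousSubmodule σ ℝ (k + 2)) := by
  let A := (polyLaplacian σ).domRestrict (homogeneousSubmodule σ ℝ (k + 2))
  have hr : LinearMap.range A = homogeneousSubmodule σ ℝ k := by
    ext q
    constructor
    · rintro ⟨p, rfl⟩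
      exact IsHomogeneous.polyLaplacian p.2
    · intro hq
      rw [← fischerSpan_eq] at hq
      obtain ⟨u, hu, huq⟩ := exists_polyLaplacian_eq_of_mem_fischerSpan hq
      exact ⟨⟨u, fischerSpan_le _ hu⟩, huq⟩
  have hk : (LinearMap.ker A).map (homogeneousSubmodule σ ℝ (k + 2)).subtype =
      harmonicPoly σ (k + 2) := by
    rw [LinearMap.ker_domRestrict, Submodule.map_comap_subtype, harmonicPoly]
  rw [← LinearMap.finrank_range_add_finrank_ker A, hr, ← hk, Submodule.finrank_map_subtype_eq,
    add_comm]

lemma finrank_homogeneousSubmodule (d k : ℕ) :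
    Module.finrank ℝ (homogeneousSubmodule (Fin (d + 1)) ℝ k) = (d + k).choose d := by
  classical
  rw [homogeneousSubmodule_eq_finsupp_supported]
  let e : {f : Fin (d + 1) →₀ ℕ | f.degree = k} ≃ Sym (Fin (d + 1)) k :=
    (Equiv.subtypeEquivRight fun f => by
      simp [Finsupp.degree_apply, Finsupp.sum]).trans (Sym.equivNatSum (Fin (d + 1)) k).symm
  let : Fintype {f : Fin (d + 1) →₀ ℕ | f.degree = k} := Fintype.ofEquiv _ e.symm
  rw [(AddMonoidAlgebra.supportedEquivFinsupp _).finrank_eq, Module.finrank_finsupp_self,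
    Fintype.card_congr e, Sym.card_sym_eq_choose, Fintype.card_fin,
    show d + 1 + k - 1 = d + k by omega, Nat.choose_symm_add]

lemma harmonicPoly_of_lt_two {k : ℕ} (hk : k < 2) :
    harmonicPoly σ k = homogeneousSubmodule σ ℝ k :=
  inf_eq_left.2 fun _ hp => IsHomogeneous.polyLaplacian_eq_zero hp hk

/-- The differences of dimensions telescope with step two, leaving the full homogeneous spaces of
degrees `K` and `K-1`. For `K = 0` the second binomial vanishes because `d - 1 < d`. -/
lemma sum_finrank_harmonicPoly {d : ℕ} (hd : 1 ≤ d) (K : ℕ) :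
    ∑ k ∈ Finset.range (K + 1), Module.finrank ℝ (harmonicPoly (Fin (d + 1)) k) =
      (d + K).choose d + (d + K - 1).choose d := by
  induction K using Nat.strong_induction_on with
  | _ K ih =>
    match K with
    | 0 =>
      rw [zero_add, Finset.sum_range_one, harmonicPoly_of_lt_two zero_lt_two,
        finrank_homogeneousSubmodule, Nat.choose_eq_zero_of_lt (by omega : d + 0 - 1 < d)]
      simp
    | 1 =>
      rw [Finset.sum_range_succ, Finset.sum_range_one, harmonicPoly_of_lt_two zero_lt_two,
        harmonicPoly_of_lt_two one_lt_two, finrank_homogeneousSubmodule,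
        finrank_homogeneousSubmodule, add_comm]
      simp
    | K + 2 =>
      have h1 := finrank_harmonicPoly_add (σ := Fin (d + 1)) K
      rw [finrank_homogeneousSubmodule, finrank_homogeneousSubmodule] at h1
      have h2 := ih (K + 1) (by omega)
      rw [Finset.sum_range_succ, h2]
      simp only [show d + (K + 1) - 1 = d + K by omega, show d + (K + 2) - 1 = d + (K + 1) by omega]
      omega

end MvPolynomial

/-! ### Euclidean Laplacian of products, radial functions and dilations. -/

section LaplacianCalculus

open InnerProductSpace Filter Topology

variable {E : Type*} [NormedAddCommGroup E] [InnerProductSpace ℝ E]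

lemma ContDiffAt.differentiableAt_fderiv {f : E → ℝ} {x : E} (hf : ContDiffAt ℝ 2 f x) :
    DifferentiableAt ℝ (fderiv ℝ f) x :=
  (hf.fderiv_right (m := 1) (by norm_num)).differentiableAt one_ne_zero

lemma ContDiffAt.eventually_differentiableAt {f : E → ℝ} {x : E} (hf : ContDiffAt ℝ 2 f x) :
    ∀ᶠ y in 𝓝 x, DifferentiableAt ℝ f y :=
  (hf.eventually (by simp)).mono fun _ hy => hy.differentiableAt two_ne_zero

lemma hasFDerivAt_comp_norm_sq {φ : ℝ → ℝ} {x : E} (hφ : DifferentiableAt ℝ φ (‖x‖ ^ 2)) :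
    HasFDerivAt (fun y : E => φ (‖y‖ ^ 2)) ((2 * deriv φ (‖x‖ ^ 2)) • innerSL ℝ x) x := by
  have := hφ.hasDerivAt.comp_hasFDerivAt x (hasStrictFDerivAt_norm_sq x).hasFDerivAt
  convert! this using 1
  ext h
  simp
  ring

lemma ContDiffAt.comp_norm_sq {n : ℕ∞ω} {φ : ℝ → ℝ} {x : E} (hφ : ContDiffAt ℝ n φ (‖x‖ ^ 2)) :
    ContDiffAt ℝ n (fun y : E => φ (‖y‖ ^ 2)) x :=
  hφ.comp x (contDiff_norm_sq ℝ).contDiffAt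

variable [FiniteDimensional ℝ E] {ι : Type*} [Fintype ι]

lemma laplacian_eq_sum_fderiv_fderiv (b : OrthonormalBasis ι ℝ E) (f : E → ℝ) (x : E) :
    Δ f x = ∑ i, fderiv ℝ (fderiv ℝ f) x (b i) (b i) := by
  simp [laplacian_eq_iteratedFDeriv_orthonormalBasis f b, iteratedFDeriv_two_apply]

/-- The product rule for the Laplacian. -/
lemma ContDiffAt.laplacian_mul (b : OrthonormalBasis ι ℝ E) {u v : E → ℝ} {x : E}
    (hu : ContDiffAt ℝ 2 u x) (hv : ContDiffAt ℝ 2 v x) :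
    Δ (fun y => u y * v y) x = u x * Δ v x + v x * Δ u x +
      2 * ∑ i, fderiv ℝ u x (b i) * fderiv ℝ v x (b i) := by
  have h1 : fderiv ℝ (fun y => u y * v y) =ᶠ[𝓝 x]
      fun y => u y • fderiv ℝ v y + v y • fderiv ℝ u y := by
    filter_upwards [hu.eventually_differentiableAt, hv.eventually_differentiableAt] with y h h'
    exact fderiv_fun_mul h h'
  have hud := hu.differentiableAt two_ne_zero
  have hvd := hv.differentiableAt two_ne_zero
  have h2 := (hud.hasFDerivAt.smul hv.differentiableAt_fderiv.hasFDerivAt).add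
    (hvd.hasFDerivAt.smul hu.differentiableAt_fderiv.hasFDerivAt)
  simp only [laplacian_eq_sum_fderiv_fderiv b]
  rw [h1.fderiv_eq, show fderiv ℝ (fun y => u y • fderiv ℝ v y + v y • fderiv ℝ u y) x = _ from
    h2.fderiv, Finset.mul_sum, Finset.mul_sum, Finset.mul_sum, ← Finset.sum_add_distrib,
    ← Finset.sum_add_distrib]
  refine Finset.sum_congr rfl fun i _ => ?_
  simp
  ring

lemma laplacian_comp_norm_sq {φ : ℝ → ℝ} {x : E} (hφ : ContDiffAt ℝ 2 φ (‖x‖ ^ 2)) :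
    Δ (fun y : E => φ (‖y‖ ^ 2)) x = 4 * ‖x‖ ^ 2 * deriv (deriv φ) (‖x‖ ^ 2) +
      2 * Module.finrank ℝ E * deriv φ (‖x‖ ^ 2) := by
  have hc : ContinuousAt (fun y : E => ‖y‖ ^ 2) x := by fun_prop
  have h1 : fderiv ℝ (fun y : E => φ (‖y‖ ^ 2)) =ᶠ[𝓝 x]
      fun y => (2 * deriv φ (‖y‖ ^ 2)) • innerSL ℝ y := by
    filter_upwards [hc.eventually hφ.eventually_differentiableAt] with y hy
    exact (hasFDerivAt_comp_norm_sq hy).fderiv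
  have hd : DifferentiableAt ℝ (deriv φ) (‖x‖ ^ 2) :=
    hφ.differentiableAt_fderiv.clm_apply (differentiableAt_const 1)
  have h2 := ((hasFDerivAt_comp_norm_sq hd).const_mul 2).smul (innerSL ℝ (E := E)).hasFDerivAt
  let b := stdOrthonormalBasis ℝ E
  rw [laplacian_eq_sum_fderiv_fderiv b, h1.fderiv_eq,
    show fderiv ℝ (fun y : E => (2 * deriv φ (‖y‖ ^ 2)) • innerSL ℝ y) x = _ from h2.fderiv]
  have h3 : ∑ i, inner ℝ x (b i) ^ 2 = ‖x‖ ^ 2 := by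
    simpa using b.sum_sq_norm_inner_left x
  have h4 : ∀ i, innerSL ℝ (b i) (b i) = 1 := fun i => by simp
  trans ∑ i, (4 * deriv (deriv φ) (‖x‖ ^ 2) * inner ℝ x (b i) ^ 2 + 2 * deriv φ (‖x‖ ^ 2))
  · refine Finset.sum_congr rfl fun i _ => ?_
    simp only [add_apply, smul_apply, ContinuousLinearMap.smulRight_apply, innerSL_apply_apply,
      smul_eq_mul]
    erw [h4 i, innerSL_apply_apply ℝ x (b i)]
    ring
  · rw [Finset.sum_add_distrib, ← Finset.mul_sum, h3]
    simp
    ring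

/-- The Laplacian of the product of a radial function with a function of vanishing radial
derivative. -/
lemma laplacian_comp_norm_sq_mul {φ : ℝ → ℝ} {v : E → ℝ} {x : E}
    (hφ : ContDiffAt ℝ 2 φ (‖x‖ ^ 2)) (hv : ContDiffAt ℝ 2 v x) (hvx : fderiv ℝ v x x = 0) :
    Δ (fun y => φ (‖y‖ ^ 2) * v y) x =
      φ (‖x‖ ^ 2) * Δ v x + v x * Δ (fun y : E => φ (‖y‖ ^ 2)) x := by
  let b := stdOrthonormalBasis ℝ E
  -- The gradient of a radial function is parallel to `x`, so the cross term of the product rule is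
  -- a multiple of this radial derivative.
  have h : fderiv ℝ v x x = ∑ i, inner ℝ x (b i) * fderiv ℝ v x (b i) := by
    have := congrArg (fderiv ℝ v x) (b.sum_repr' x)
    rw [← this]
    simp [real_inner_comm]
  rw [hφ.comp_norm_sq.laplacian_mul b hv,
    (hasFDerivAt_comp_norm_sq (hφ.differentiableAt two_ne_zero)).fderiv]
  simp only [smul_apply, innerSL_apply_apply, smul_eq_mul, mul_assoc,
    ← Finset.mul_sum]
  rw [← h, hvx]
  ring

lemma laplacian_comp_smul_apply {f : E → ℝ} (c : ℝ) (x : E) :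
    Δ (fun y => f (c • y)) x = c ^ 2 * Δ f (c • x) := by
  have h1 : fderiv ℝ (fun y => f (c • y)) = fun y => c • fderiv ℝ f (c • y) := by
    funext y
    exact fderiv_comp_smul ..
  let b := stdOrthonormalBasis ℝ E
  simp only [laplacian_eq_sum_fderiv_fderiv b, h1, Finset.mul_sum]
  refine Finset.sum_congr rfl fun i _ => ?_
  have h2 : fderiv ℝ (fun y => c • fderiv ℝ f (c • y)) x =
      c • c • fderiv ℝ (fderiv ℝ f) (c • x) := by
    rw [← fderiv_comp_smul (f := fderiv ℝ f)]
    exact congrFun (fderiv_const_smul_field (𝕜 := ℝ) (R := ℝ)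
      (f := fun y => fderiv ℝ f (c • y)) c) x
  rw [h2]
  simp
  ring

end LaplacianCalculus

/-! ### Degree-zero extensions of functions on the sphere. -/

section RadialExtension

open InnerProductSpace Filter Topology

variable {d : ℕ}

lemma radialExtension_coe (f : UnitSphere d → ℝ) (x : UnitSphere d) :
    radialExtension f (x : Ambient d) = f x := by
  have hx : ‖(x : Ambient d)‖ = 1 := norm_eq_of_mem_sphere x
  rw [radialExtension, dif_neg (ne_zero_of_mem_unit_sphere x)]
  congr 1
  ext1
  simp [hx]

lemma radialExtension_mul (f g : UnitSphere d → ℝ) :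
    radialExtension (f * g) = radialExtension f * radialExtension g := by
  funext y
  by_cases h : y = 0 <;> simp [radialExtension, h]

lemma radialExtension_smul_apply (f : UnitSphere d → ℝ) {c : ℝ} (hc : 0 < c) (y : Ambient d) :
    radialExtension f (c • y) = radialExtension f y := by
  by_cases h : y = 0
  · simp [h]
  · rw [radialExtension, radialExtension, dif_neg h, dif_neg (smul_ne_zero hc.ne' h)]
    congr 2
    rw [norm_smul, Real.norm_of_nonneg hc.le, smul_smul]
    congr 1
    field_simp

lemma radialExtension_of_ne_zero (f : UnitSphere d → ℝ) {y : Ambient d} (hy : y ≠ 0) :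
    ∃ x : UnitSphere d, y = ‖y‖ • (x : Ambient d) ∧ radialExtension f y = f x :=
  ⟨⟨‖y‖⁻¹ • y, by simp [norm_smul, norm_ne_zero_iff.mpr hy]⟩, by
    simp [norm_ne_zero_iff.mpr hy], by simp [radialExtension, hy]⟩

lemma fderiv_radialExtension_self {f : UnitSphere d → ℝ}
    (hf : ContMDiff (𝓡 d) 𝓘(ℝ, ℝ) ∞ f) {y : Ambient d} (hy : y ≠ 0) :
    fderiv ℝ (radialExtension f) y y = 0 := by
  have h1 : HasFDerivAt (radialExtension f) (fderiv ℝ (radialExtension f) y) ((1 : ℝ) • y) := by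
    rw [one_smul]
    exact ((contDiffAt_radialExtension hf hy).differentiableAt (by simp)).hasFDerivAt
  have h2 : HasDerivAt (fun t : ℝ => t • y) ((1 : ℝ) • y) 1 := (hasDerivAt_id (1 : ℝ)).smul_const y
  have h3 := h1.comp_hasDerivAt (1 : ℝ) h2
  have h4 : (radialExtension f ∘ fun t : ℝ => t • y) =ᶠ[𝓝 1] fun _ => radialExtension f y := by
    filter_upwards [eventually_gt_nhds (zero_lt_one' ℝ)] with t ht
    exact radialExtension_smul_apply f ht y
  simpa using h3.unique ((hasDerivAt_const _ _).congr_of_eventuallyEq h4)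

/-- The extension is invariant under positive dilations, so its Laplacian is homogeneous of degree
`-2`; this carries the eigenvalue equation from the sphere to all `y ≠ 0`. -/
lemma laplacian_radialExtension {f : UnitSphere d → ℝ} {μ : ℝ} (hf : f ∈ laplaceEigenspace d μ)
    {y : Ambient d} (hy : y ≠ 0) :
    Δ (radialExtension f) y = -(μ * (‖y‖ ^ 2)⁻¹ * radialExtension f y) := by
  obtain ⟨x, hyx, hfx⟩ := radialExtension_of_ne_zero f hy
  have hr : 0 < ‖y‖ := norm_pos_iff.2 hy
  have h1 := laplacian_comp_smul_apply (f := radialExtension f) ‖y‖ (x : Ambient d)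
  rw [← hyx, show (fun z => radialExtension f (‖y‖ • z)) = radialExtension f from
    funext fun z => radialExtension_smul_apply f hr z] at h1
  have h2 : -Δ (radialExtension f) (x : Ambient d) = μ * f x := hf.2 x
  rw [hfx]
  field_simp
  linarith

end RadialExtension

/-! ### Spherical harmonics are eigenfunctions. -/

section PolynomialFunctions

open InnerProductSpace Filter Topology MvPolynomial

variable {d : ℕ}

/-- The function on `ℝ^{d+1}` defined by a polynomial. -/
noncomputable def polyFun (p : MvPolynomial (Fin (d + 1)) ℝ) (y : Ambient d) : ℝ :=
  eval (fun i => y i) p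

lemma contDiff_polyFun (p : MvPolynomial (Fin (d + 1)) ℝ) {n : ℕ∞ω} : ContDiff ℝ n (polyFun p) := by
  unfold polyFun
  induction p using MvPolynomial.induction_on with
  | C a => simpa using (contDiff_const : ContDiff ℝ n fun _ : Ambient d => a)
  | add p q hp hq => simpa using hp.add hq
  | mul_X p i hp =>
    have : ContDiff ℝ n fun y : Ambient d => y i := by fun_prop
    simpa using hp.mul this

lemma fderiv_polyFun (p : MvPolynomial (Fin (d + 1)) ℝ) (y : Ambient d) (i : Fin (d + 1)) :
    fderiv ℝ (polyFun p) y (EuclideanSpace.single i 1) = polyFun (pderiv i p) y := by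
  have hd (p : MvPolynomial (Fin (d + 1)) ℝ) : DifferentiableAt ℝ (polyFun p) y :=
    (contDiff_polyFun p (n := 1)).contDiffAt.differentiableAt one_ne_zero
  induction p using MvPolynomial.induction_on with
  | C a =>
    rw [show polyFun (C a) = fun _ : Ambient d => a from funext fun y => by simp [polyFun]]
    simp [polyFun]
  | add p q hp hq =>
    rw [show polyFun (p + q) = polyFun p + polyFun q from funext fun y => by simp [polyFun],
      fderiv_add (hd p) (hd q), add_apply, hp, hq]
    simp [polyFun]
  | mul_X p j hp =>
    have hX : HasFDerivAt (fun y : Ambient d => y j) (EuclideanSpace.proj (𝕜 := ℝ) j) y :=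
      (EuclideanSpace.proj (𝕜 := ℝ) j).hasFDerivAt
    rw [show polyFun (p * X j) = fun y => polyFun p y * y j from funext fun y => by simp [polyFun],
      fderiv_fun_mul (hd p) hX.differentiableAt, hX.fderiv]
    simp only [add_apply, smul_apply, hp]
    by_cases hij : i = j
    · subst hij
      simp [polyFun]
    · simp [polyFun, Ne.symm hij]

lemma laplacian_polyFun (p : MvPolynomial (Fin (d + 1)) ℝ) (y : Ambient d) :
    Δ (polyFun p) y = polyFun (polyLaplacian _ p) y := by
  rw [laplacian_eq_sum_fderiv_fderiv (EuclideanSpace.basisFun (Fin (d + 1)) ℝ),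
    polyLaplacian_apply]
  simp only [EuclideanSpace.basisFun_apply, polyFun, map_sum]
  refine Finset.sum_congr rfl fun i _ => ?_
  have h1 := ((contDiff_polyFun p (n := 2)).contDiffAt (x := y)).differentiableAt_fderiv
  have h2 : (fun z => fderiv ℝ (polyFun p) z (EuclideanSpace.single i 1)) =
      polyFun (pderiv i p) := funext fun z => fderiv_polyFun p z i
  rw [← polyFun, ← fderiv_polyFun, ← h2, fderiv_clm_apply h1 (differentiableAt_const _)]
  simp

lemma polyFun_smul {p : MvPolynomial (Fin (d + 1)) ℝ} {k : ℕ} (hp : p.IsHomogeneous k) (c : ℝ)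
    (y : Ambient d) : polyFun p (c • y) = c ^ k * polyFun p y := by
  simp only [polyFun, eval_eq, Finset.mul_sum]
  refine Finset.sum_congr rfl fun s hs => ?_
  rw [hp.degree_eq_sum_deg_support hs]
  simp only [PiLp.smul_apply, smul_eq_mul, mul_pow, Finset.prod_mul_distrib,
    Finset.prod_pow_eq_pow_sum]
  ring

/-- The restriction of a polynomial to the sphere. -/
noncomputable def sphereRestrict (d : ℕ) : MvPolynomial (Fin (d + 1)) ℝ →ₗ[ℝ] UnitSphere d → ℝ where
  toFun p x := polyFun p x
  map_add' p q := by funext x; simp [polyFun]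
  map_smul' c p := by funext x; simp [polyFun]

lemma sphereRestrict_apply (p : MvPolynomial (Fin (d + 1)) ℝ) (x : UnitSphere d) :
    sphereRestrict d p x = polyFun p x := rfl

lemma contMDiff_sphereRestrict (p : MvPolynomial (Fin (d + 1)) ℝ) :
    ContMDiff (𝓡 d) 𝓘(ℝ, ℝ) ∞ (sphereRestrict d p) := by
  have := Fact.mk (@finrank_euclideanSpace_fin ℝ _ (d + 1))
  exact (contDiff_polyFun p).contMDiff.comp contMDiff_coe_sphere

/-- The radial factor `|y|^k` is written as a function of `|y|²` to match
`laplacian_comp_norm_sq_mul`. -/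
lemma polyFun_eq_norm_sq_rpow_mul {p : MvPolynomial (Fin (d + 1)) ℝ} {k : ℕ}
    (hp : p.IsHomogeneous k) {y : Ambient d} (hy : y ≠ 0) :
    polyFun p y = (‖y‖ ^ 2) ^ ((k : ℝ) / 2) * radialExtension (sphereRestrict d p) y := by
  obtain ⟨x, hyx, h⟩ := radialExtension_of_ne_zero (sphereRestrict d p) hy
  rw [h, sphereRestrict_apply]
  conv_lhs => rw [hyx, polyFun_smul hp]
  rw [← Real.rpow_natCast ‖y‖ 2, ← Real.rpow_mul (norm_nonneg y), Nat.cast_ofNat,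
    mul_div_cancel₀ _ two_ne_zero, Real.rpow_natCast]

lemma eq_zero_of_sphereRestrict_eq_zero {p : MvPolynomial (Fin (d + 1)) ℝ} {k : ℕ}
    (hp : p.IsHomogeneous k) (h : sphereRestrict d p = 0) : p = 0 := by
  have h1 : ∀ y : Ambient d, y ≠ 0 → polyFun p y = 0 := fun y hy => by
    obtain ⟨x, -, hx⟩ := radialExtension_of_ne_zero (sphereRestrict d p) hy
    rw [polyFun_eq_norm_sq_rpow_mul hp hy, hx, h]
    simp
  have h2 : polyFun p = fun _ => 0 := by
    refine (contDiff_polyFun p (n := 0)).continuous.ext_on (dense_compl_singleton 0)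
      continuous_const fun y hy => h1 y hy
  exact hp.eq_zero_of_forall_eval_eq_zero fun r => congrFun h2 (WithLp.toLp 2 r)

/-- Restrictions of homogeneous harmonic polynomials of degree `k` are eigenfunctions. -/
lemma sphereRestrict_mem_laplaceEigenspace {p : MvPolynomial (Fin (d + 1)) ℝ} {k : ℕ}
    (hp : p ∈ harmonicPoly (Fin (d + 1)) k) :
    sphereRestrict d p ∈ laplaceEigenspace d (k * (k + d - 1)) := by
  refine ⟨contMDiff_sphereRestrict p, fun x => ?_⟩
  have hF := contMDiff_sphereRestrict p
  have hx0 : (x : Ambient d) ≠ 0 := ne_zero_of_mem_unit_sphere x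
  have hx1 : ‖(x : Ambient d)‖ ^ 2 = 1 := by
    rw [show ‖(x : Ambient d)‖ = 1 from norm_eq_of_mem_sphere x, one_pow]
  let φ : ℝ → ℝ := fun s => s ^ ((k : ℝ) / 2)
  have hd1 : deriv φ =ᶠ[𝓝 1] fun s => (k : ℝ) / 2 * s ^ ((k : ℝ) / 2 - 1) := by
    filter_upwards [isOpen_compl_singleton.mem_nhds (one_ne_zero' ℝ)] with s hs
    exact (Real.hasDerivAt_rpow_const (Or.inl hs)).deriv
  have hφ : ContDiffAt ℝ 2 φ (‖(x : Ambient d)‖ ^ 2) := by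
    rw [hx1]
    exact Real.contDiffAt_rpow_const_of_ne one_ne_zero
  have h0 : Δ (polyFun p) (x : Ambient d) = 0 := by
    rw [laplacian_polyFun, show polyLaplacian _ p = 0 from hp.2]
    simp [polyFun]
  have h1 : polyFun p =ᶠ[𝓝 (x : Ambient d)] fun y => φ (‖y‖ ^ 2) * radialExtension (sphereRestrict d p) y := by
    filter_upwards [isOpen_compl_singleton.mem_nhds hx0] with y hy
    exact polyFun_eq_norm_sq_rpow_mul hp.1 hy
  -- The radial extension has no radial derivative, so `0 = Δp` splits on the sphere into its
  -- Laplacian plus its value times `Δ|y|^k = k(k-2) + (d+1)k = k(k+d-1)`.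
  rw [(laplacian_congr_nhds h1).eq_of_nhds, laplacian_comp_norm_sq_mul hφ
    (contDiffAt_two_radialExtension hF x) (fderiv_radialExtension_self hF hx0),
    laplacian_comp_norm_sq hφ, hx1] at h0
  have h2 : deriv φ 1 = (k : ℝ) / 2 := by
    simp [φ]
  have h3 : deriv (deriv φ) 1 = (k : ℝ) / 2 * ((k : ℝ) / 2 - 1) := by
    rw [hd1.deriv_eq]
    simp
  rw [h2, h3, radialExtension_coe, show φ 1 = 1 by simp [φ], finrank_euclideanSpace_fin] at h0
  rw [laplaceBeltrami]
  push_cast at h0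
  linear_combination -h0

end PolynomialFunctions

/-! ### Orthogonality of eigenfunctions via a radial cutoff. -/

section Orthogonality

open InnerProductSpace Filter Topology MvPolynomial MeasureTheory

variable {d : ℕ}

/-- A smooth cutoff function on the real line supported in `[1/2, 3/2]`. -/
noncomputable def radialCutoff : ContDiffBump (1 : ℝ) where
  rIn := 1 / 4
  rOut := 1 / 2
  rIn_pos := by norm_num
  rIn_lt_rOut := by norm_num

lemma radialCutoff_one : radialCutoff 1 = 1 :=
  radialCutoff.one_of_mem_closedBall (Metric.mem_closedBall_self radialCutoff.rIn_pos.le)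

lemma radialCutoff_of_le_half {t : ℝ} (ht : t ≤ 1 / 2) : radialCutoff t = 0 := by
  refine radialCutoff.zero_of_le_dist ?_
  rw [Real.dist_eq, abs_sub_comm]
  exact le_trans (by norm_num [radialCutoff]; linarith) (le_abs_self _)

lemma radialCutoff_of_two_le {t : ℝ} (ht : 2 ≤ t) : radialCutoff t = 0 := by
  refine radialCutoff.zero_of_le_dist ?_
  rw [Real.dist_eq]
  exact le_trans (by norm_num [radialCutoff]; linarith) (le_abs_self _)

lemma eventually_radialCutoff_norm_sq_eq_zero :
    ∀ᶠ y : Ambient d in 𝓝 0, radialCutoff (‖y‖ ^ 2) = 0 := by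
  have h : ContinuousAt (fun y : Ambient d => ‖y‖ ^ 2) 0 := by fun_prop
  have h2 : ∀ᶠ t in 𝓝 (‖(0 : Ambient d)‖ ^ 2), t < 1 / 2 :=
    eventually_lt_nhds (by norm_num)
  exact (h.eventually h2).mono fun y hy => radialCutoff_of_le_half hy.le

lemma hasCompactSupport_of_radialCutoff {F : Ambient d → ℝ}
    (hF : ∀ y, radialCutoff (‖y‖ ^ 2) = 0 → F y = 0) : HasCompactSupport F := by
  refine HasCompactSupport.intro (isCompact_closedBall 0 2) fun y hy => hF y ?_
  rw [mem_closedBall_zero_iff, not_le] at hy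
  exact radialCutoff_of_two_le (by nlinarith)

/-- A radial weight on `ℝ^{d+1}` supported in an annulus around the unit sphere. -/
noncomputable def radialWeight (y : Ambient d) : ℝ := radialCutoff (‖y‖ ^ 2) ^ 2 * (‖y‖ ^ 2)⁻¹

lemma radialWeight_nonneg (y : Ambient d) : 0 ≤ radialWeight y := by
  unfold radialWeight
  positivity

lemma continuousAt_radialExtension {f : UnitSphere d → ℝ} (hf : Continuous f) {y : Ambient d}
    (hy : y ≠ 0) : ContinuousAt (radialExtension f) y := by
  have h : ContinuousOn (radialExtension f) {0}ᶜ := by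
    rw [continuousOn_iff_continuous_domRestrict]
    have h1 : Continuous fun u : ({0}ᶜ : Set (Ambient d)) =>
        (⟨‖(u : Ambient d)‖⁻¹ • (u : Ambient d), by
          have : (u : Ambient d) ≠ 0 := u.2
          simp [norm_smul, norm_ne_zero_iff.mpr this]⟩ : UnitSphere d) := by
      refine Continuous.subtype_mk ?_ _
      refine Continuous.smul (Continuous.inv₀ continuous_subtype_val.norm fun u => ?_)
        continuous_subtype_val
      exact norm_ne_zero_iff.mpr u.2
    refine (hf.comp h1).congr fun u => ?_
    have : (u : Ambient d) ≠ 0 := u.2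
    simp [radialExtension, this]
  exact h.continuousAt (isOpen_compl_singleton.mem_nhds hy)

lemma continuous_radialWeight_mul {f : UnitSphere d → ℝ} (hf : Continuous f) :
    Continuous fun y : Ambient d => radialWeight y * radialExtension f y := by
  refine continuous_iff_continuousAt.2 fun y => ?_
  by_cases hy : y = 0
  · subst hy
    refine (continuousAt_const (y := (0 : ℝ))).congr ?_
    filter_upwards [eventually_radialCutoff_norm_sq_eq_zero (d := d)] with y hy
    simp [radialWeight, hy]
  · refine ContinuousAt.mul ?_ (continuousAt_radialExtension hf hy)
    have h : ContinuousAt (fun z : Ambient d => radialCutoff (‖z‖ ^ 2)) y :=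
      (radialCutoff.continuous.comp (by fun_prop)).continuousAt
    exact (h.pow 2).mul (ContinuousAt.inv₀ (by fun_prop) (by simpa using hy))

lemma integrable_radialWeight_mul {f : UnitSphere d → ℝ} (hf : Continuous f) :
    Integrable fun y : Ambient d => radialWeight y * radialExtension f y :=
  (continuous_radialWeight_mul hf).integrable_of_hasCompactSupport
    (hasCompactSupport_of_radialCutoff fun y hy => by simp [radialWeight, hy])

lemma contDiff_radialCutoff_mul {f : UnitSphere d → ℝ} (hf : ContMDiff (𝓡 d) 𝓘(ℝ, ℝ) ∞ f) :
    ContDiff ℝ ∞ fun y : Ambient d => radialCutoff (‖y‖ ^ 2) * radialExtension f y := by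
  refine contDiff_iff_contDiffAt.2 fun y => ?_
  by_cases hy : y = 0
  · subst hy
    refine (contDiffAt_const (c := (0 : ℝ))).congr_of_eventuallyEq ?_
    filter_upwards [eventually_radialCutoff_norm_sq_eq_zero (d := d)] with y hy
    simp [hy]
  · exact (radialCutoff.contDiff.contDiffAt.comp_norm_sq).mul (contDiffAt_radialExtension hf hy)

/-- Green's identity for `u = χF` and `v = χG`, with `F`, `G` the extensions and `χ` the radial
cutoff. In `uΔv - vΔu` the terms with `Δχ` cancel, leaving `(μ-ν) χ² |y|⁻² F G`; this dictates the
form of `radialWeight`. -/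
lemma integral_radialWeight_mul_eq_zero {μ ν : ℝ} {f g : UnitSphere d → ℝ}
    (hf : f ∈ laplaceEigenspace d μ) (hg : g ∈ laplaceEigenspace d ν) (hμν : μ ≠ ν) :
    ∫ y : Ambient d, radialWeight y * radialExtension (f * g) y = 0 := by
  let U {h : UnitSphere d → ℝ} (hh : ContMDiff (𝓡 d) 𝓘(ℝ, ℝ) ∞ h) : SchwartzMap (Ambient d) ℝ :=
    (hasCompactSupport_of_radialCutoff fun y hy => by simp [hy]).toSchwartzMap
      (contDiff_radialCutoff_mul hh)
  have hU {h : UnitSphere d → ℝ} (hh : ContMDiff (𝓡 d) 𝓘(ℝ, ℝ) ∞ h) (y : Ambient d) :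
    U hh y = radialCutoff (‖y‖ ^ 2) * radialExtension h y := rfl
  have hΔ {h : UnitSphere d → ℝ} {κ : ℝ} (hh : h ∈ laplaceEigenspace d κ) {y : Ambient d}
      (hy : y ≠ 0) : Δ (U hh.1) y = -(κ * (‖y‖ ^ 2)⁻¹ * U hh.1 y) + radialExtension h y *
        Δ (fun z : Ambient d => radialCutoff (‖z‖ ^ 2)) y := by
    rw [SchwartzMap.laplacian_apply, hU hh.1,
      show ⇑(U hh.1) = fun y => radialCutoff (‖y‖ ^ 2) * radialExtension h y from rfl,
      laplacian_comp_norm_sq_mul radialCutoff.contDiff.contDiffAt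
      ((contDiffAt_radialExtension hh.1 hy).of_le (by norm_cast))
      (fderiv_radialExtension_self hh.1 hy), laplacian_radialExtension hh hy]
    ring
  have h1 := SchwartzMap.integral_mul_laplacian_right_eq_left (μ := volume) (U hf.1) (U hg.1)
  have h2 : ∀ y, (μ - ν) * (radialWeight y * radialExtension (f * g) y) =
      U hf.1 y * Δ (U hg.1) y - Δ (U hf.1) y * U hg.1 y := fun y => by
    by_cases hy : y = 0
    · have h0 : radialCutoff (‖y‖ ^ 2) = 0 := radialCutoff_of_le_half (by rw [hy]; norm_num)
      simp [hU, radialWeight, h0]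
    · rw [hΔ hf hy, hΔ hg hy, hU hf.1, hU hg.1, radialExtension_mul, radialWeight, Pi.mul_apply]
      ring
  have h3 : (μ - ν) * ∫ y : Ambient d, radialWeight y * radialExtension (f * g) y = 0 := by
    rw [← integral_const_mul, integral_congr_ae (Eventually.of_forall h2), integral_sub, h1,
      sub_self]
    · exact (SchwartzMap.pairing (ContinuousLinearMap.mul ℝ ℝ) (U hf.1) (Δ (U hg.1))).integrable
    · exact (SchwartzMap.pairing (ContinuousLinearMap.mul ℝ ℝ) (Δ (U hf.1)) (U hg.1)).integrable
  exact (mul_eq_zero.1 h3).resolve_left (sub_ne_zero.2 hμν)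

end Orthogonality

/-! ### Completeness of spherical harmonics. -/

section Completeness

open InnerProductSpace Filter Topology MvPolynomial MeasureTheory

variable {d : ℕ}

lemma abs_radialExtension_le (f : C(UnitSphere d, ℝ)) (y : Ambient d) :
    |radialExtension f y| ≤ ‖f‖ := by
  by_cases hy : y = 0
  · simp [radialExtension, hy]
  · obtain ⟨x, -, h⟩ := radialExtension_of_ne_zero f hy
    rw [h]
    exact f.norm_coe_le_norm x

/-- A continuous, strictly positive functional on `C(S^d)`: integration over an annulus against
a radial weight. -/
noncomputable def sphereIntegral (d : ℕ) : C(UnitSphere d, ℝ) →L[ℝ] ℝ :=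
  LinearMap.mkContinuous
    { toFun f := ∫ y : Ambient d, radialWeight y * radialExtension f y
      map_add' f g := by
        rw [← integral_add (integrable_radialWeight_mul f.continuous)
          (integrable_radialWeight_mul g.continuous)]
        simp [radialExtension_add, mul_add]
      map_smul' c f := by
        rw [RingHom.id_apply, smul_eq_mul, ← integral_const_mul]
        simp [radialExtension_smul, mul_left_comm] }
    (∫ y : Ambient d, radialWeight y * radialExtension (1 : C(UnitSphere d, ℝ)) y) fun f => by
      rw [mul_comm, ← integral_const_mul]
      refine norm_integral_le_of_norm_le
        ((integrable_radialWeight_mul (1 : C(UnitSphere d, ℝ)).continuous).const_mul _)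
        (Eventually.of_forall fun y => ?_)
      by_cases hy : y = 0
      · simp [radialExtension, hy]
      · rw [norm_mul, Real.norm_of_nonneg (radialWeight_nonneg y), mul_left_comm]
        refine mul_le_mul_of_nonneg_left ?_ (radialWeight_nonneg y)
        simpa [radialExtension, hy] using abs_radialExtension_le f y

lemma sphereIntegral_apply (f : C(UnitSphere d, ℝ)) :
    sphereIntegral d f = ∫ y : Ambient d, radialWeight y * radialExtension f y := rfl

/-- A continuous nonnegative integrand with zero integral vanishes everywhere, in particular on the
sphere, where the weight is `1`. -/
lemma eq_zero_of_sphereIntegral_mul_self {f : C(UnitSphere d, ℝ)}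
    (h : sphereIntegral d (f * f) = 0) : f = 0 := by
  have hn : 0 ≤ fun y : Ambient d => radialWeight y * radialExtension (f * f : C(_, ℝ)) y :=
    fun y => mul_nonneg (radialWeight_nonneg y) (by
      rw [ContinuousMap.coe_mul, radialExtension_mul]
      exact mul_self_nonneg _)
  rw [sphereIntegral_apply, integral_eq_zero_iff_of_nonneg hn
    (integrable_radialWeight_mul (f * f).continuous),
    (continuous_radialWeight_mul (f * f).continuous).ae_eq_iff_eq _ continuous_zero] at h
  ext x
  have h1 := congrFun h (x : Ambient d)
  rw [radialExtension_coe, radialWeight, norm_eq_of_mem_sphere x] at h1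
  simpa [radialCutoff_one] using h1

/-- The restriction of a polynomial to the sphere, as a continuous map. -/
noncomputable def sphereRestrictC (d : ℕ) :
    MvPolynomial (Fin (d + 1)) ℝ →ₐ[ℝ] C(UnitSphere d, ℝ) :=
  aeval fun i => ⟨fun x => (x : Ambient d) i, by fun_prop⟩

lemma coe_sphereRestrictC (p : MvPolynomial (Fin (d + 1)) ℝ) :
    ⇑(sphereRestrictC d p) = sphereRestrict d p := by
  funext x
  rw [sphereRestrict_apply, polyFun]
  induction p using MvPolynomial.induction_on with
  | C a => simp [sphereRestrictC]
  | add p q hp hq => simp [hp, hq]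
  | mul_X p i hp =>
    rw [map_mul, map_mul, ContinuousMap.mul_apply, hp]
    simp [sphereRestrictC]

/-- Stone–Weierstrass: the coordinates separate points. -/
lemma dense_range_sphereRestrictC : DenseRange (sphereRestrictC d) := by
  have h := ContinuousMap.subalgebra_topologicalClosure_eq_top_of_separatesPoints
    (sphereRestrictC d).range fun x y hxy => by
      obtain ⟨i, hi⟩ : ∃ i, (x : Ambient d) i ≠ (y : Ambient d) i := by
        by_contra! h
        exact hxy (Subtype.ext (PiLp.ext h))
      exact ⟨_, ⟨sphereRestrictC d (X i), ⟨X i, rfl⟩, rfl⟩, by simpa [sphereRestrictC] using hi⟩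
  intro f
  have : f ∈ (sphereRestrictC d).range.topologicalClosure := h ▸ trivial
  exact this

lemma sphereRestrictC_normSqPoly : sphereRestrictC d (normSqPoly _) = 1 := by
  ext x
  have := EuclideanSpace.real_norm_sq_eq (x : Ambient d)
  rw [norm_eq_of_mem_sphere x] at this
  simp [sphereRestrictC, normSqPoly, ← this]

/-- A continuous function on the sphere that is orthogonal to all spherical harmonics vanishes. -/
theorem eq_zero_of_forall_harmonicPoly {f : C(UnitSphere d, ℝ)}
    (h : ∀ k, ∀ p ∈ harmonicPoly (Fin (d + 1)) k,
      sphereIntegral d (f * sphereRestrictC d p) = 0) : f = 0 := by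
  let A : MvPolynomial (Fin (d + 1)) ℝ →ₗ[ℝ] ℝ :=
    (sphereIntegral d).toLinearMap ∘ₗ LinearMap.mulLeft ℝ f ∘ₗ (sphereRestrictC d).toLinearMap
  have hA (p) : A p = sphereIntegral d (f * sphereRestrictC d p) := rfl
  -- On the sphere the factors `|x|^{2j}` of the Fischer decomposition are `1`, so only the harmonic
  -- parts are tested.
  have h1 (k : ℕ) : homogeneousSubmodule (Fin (d + 1)) ℝ k ≤ LinearMap.ker A := by
    rw [← fischerSpan_eq]
    refine Submodule.span_le.2 ?_
    rintro _ ⟨j, m, p, -, hp, rfl⟩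
    rw [SetLike.mem_coe, LinearMap.mem_ker, hA, map_mul (sphereRestrictC d), map_pow, sphereRestrictC_normSqPoly,
      one_pow, one_mul]
    exact h m p hp
  have h2 (p) : sphereIntegral d (f * sphereRestrictC d p) = 0 := by
    rw [← hA, ← sum_homogeneousComponent p, map_sum]
    exact Finset.sum_eq_zero fun k _ => h1 k (homogeneousComponent_isHomogeneous k p)
  -- By density `f` is orthogonal to every continuous function, hence to itself.
  refine eq_zero_of_sphereIntegral_mul_self ?_
  exact congrFun (dense_range_sphereRestrictC.equalizer (g := fun g => sphereIntegral d (f * g))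
    (h := fun _ => 0) (by fun_prop) continuous_const (funext h2)) f

end Completeness

/-! ### Multiplicities and the exact counting function. -/

section Multiplicity

open MvPolynomial

variable {d : ℕ}

/-- An eigenfunction, as a continuous map. -/
noncomputable def eigenspaceToContinuousMap (d : ℕ) (μ : ℝ) :
    laplaceEigenspace d μ →ₗ[ℝ] C(UnitSphere d, ℝ) where
  toFun f := ⟨f, f.2.1.continuous⟩
  map_add' _ _ := rfl
  map_smul' _ _ := rfl

/-- Harmonics with a different eigenvalue are orthogonal to `f` automatically, so completeness needs
testing only against the matching degree. -/
lemma eigenspaceToContinuousMap_eq_zero {μ : ℝ} {f : laplaceEigenspace d μ}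
    (h : ∀ k : ℕ, (k * (k + d - 1) : ℝ) = μ → ∀ p ∈ harmonicPoly (Fin (d + 1)) k,
      sphereIntegral d (eigenspaceToContinuousMap d μ f * sphereRestrictC d p) = 0) : f = 0 := by
  suffices h0 : eigenspaceToContinuousMap d μ f = 0 from
    Subtype.ext (funext fun x => congrArg (fun g : C(UnitSphere d, ℝ) => g x) h0)
  refine eq_zero_of_forall_harmonicPoly fun k p hp => ?_
  by_cases hk : (k * (k + d - 1) : ℝ) = μ
  · exact h k hk p hp
  · rw [sphereIntegral_apply, ContinuousMap.coe_mul, coe_sphereRestrictC]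
    exact integral_radialWeight_mul_eq_zero f.2 (sphereRestrict_mem_laplaceEigenspace hp)
      (Ne.symm hk)

lemma laplaceMultiplicity_eq_zero {μ : ℝ} (h : ∀ k : ℕ, (k * (k + d - 1) : ℝ) ≠ μ) :
    laplaceMultiplicity d μ = 0 := by
  have : Subsingleton (laplaceEigenspace d μ) := subsingleton_of_forall_eq 0 fun f =>
    eigenspaceToContinuousMap_eq_zero fun k hk => absurd hk (h k)
  simp [laplaceMultiplicity]

lemma strictMono_sphereEigenvalue (hd : 1 ≤ d) :
    StrictMono fun k : ℕ => (k * (k + d - 1) : ℝ) := by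
  refine strictMono_nat_of_lt_succ fun k => ?_
  have h1 : (1 : ℝ) ≤ d := by exact_mod_cast hd
  have h2 : (0 : ℝ) ≤ k := k.cast_nonneg
  push_cast
  nlinarith

theorem laplaceMultiplicity_sphereEigenvalue (hd : 1 ≤ d) (k : ℕ) :
    laplaceMultiplicity d (k * (k + d - 1)) =
      Module.finrank ℝ (harmonicPoly (Fin (d + 1)) k) := by
  set H := harmonicPoly (Fin (d + 1)) k
  set V := laplaceEigenspace d (k * (k + d - 1))
  let A : H →ₗ[ℝ] V := ((sphereRestrict d).domRestrict H).codRestrict V fun p =>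
    sphereRestrict_mem_laplaceEigenspace p.2
  have hA : Function.Injective A := (injective_iff_map_eq_zero A).2 fun p hp =>
    Subtype.ext (eq_zero_of_sphereRestrict_eq_zero p.2.1 (congrArg Subtype.val hp))
  -- Pairing with harmonics embeds `V` in the dual of the finite-dimensional `H`. This bounds the
  -- rank of `V` from above without assuming it finite; `A` bounds it from below.
  let B : V →ₗ[ℝ] Module.Dual ℝ H :=
    ((LinearMap.mul ℝ C(UnitSphere d, ℝ)).compr₂ (sphereIntegral d).toLinearMap).compl₁₂
      (eigenspaceToContinuousMap d _) ((sphereRestrictC d).toLinearMap.domRestrict H)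
  have hB : Function.Injective B := (injective_iff_map_eq_zero B).2 fun f hf =>
    eigenspaceToContinuousMap_eq_zero fun j hj p hp => by
      obtain rfl : j = k := (strictMono_sphereEigenvalue hd).injective hj
      exact LinearMap.congr_fun hf ⟨p, hp⟩
  have h : Module.rank ℝ V = Module.finrank ℝ H := by
    refine le_antisymm ?_ ?_
    · refine (LinearMap.rank_le_of_injective B hB).trans ?_
      rw [← Module.finrank_eq_rank, Subspace.dual_finrank_eq]
    · rw [Module.finrank_eq_rank]
      exact LinearMap.rank_le_of_injective A hA
  rw [laplaceMultiplicity, h, Cardinal.toENat_nat]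

/-- The counting function of the Laplacian on the sphere. -/
theorem sphereCounting_eq (hd : 1 ≤ d) {z w : ℝ} (hw : 0 ≤ w) (hwz : w * (w + d - 1) = z) :
    sphereCounting d z = ((d + ⌊w⌋₊).choose d + (d + ⌊w⌋₊ - 1).choose d : ℕ) := by
  let g : ℝ → ℝ≥0∞ := fun μ => (laplaceMultiplicity d μ : ℝ≥0∞)
  let e : ℕ → ℝ := fun k => k * (k + d - 1)
  have h1 : (1 : ℝ) ≤ d := by exact_mod_cast hd
  have he (k : ℕ) : e k ≤ z ↔ k < ⌊w⌋₊ + 1 := by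
    rw [Nat.lt_succ_iff, Nat.le_floor_iff hw, ← hwz]
    have h2 : (0 : ℝ) ≤ k := k.cast_nonneg
    constructor
    · intro h
      by_contra! hlt
      have : w * (w + d - 1) < k * (k + d - 1) := by nlinarith
      exact absurd h this.not_ge
    · intro h
      change (k * (k + d - 1) : ℝ) ≤ _
      nlinarith
  -- The sum over all reals `μ ≤ z` reduces to the values of `e`, then to `k ≤ ⌊w⌋`.
  have hs : Function.support ((Set.Iic z).indicator g) ⊆ Set.range e := fun μ hμ => by
    by_contra hμe
    refine hμ ?_
    have : laplaceMultiplicity d μ = 0 := laplaceMultiplicity_eq_zero fun k hk => hμe ⟨k, hk⟩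
    simp [g, Set.indicator_apply, this]
  rw [sphereCounting, tsum_subtype (Set.Iic z) g,
    ← (strictMono_sphereEigenvalue hd).injective.tsum_eq hs,
    tsum_eq_sum (s := Finset.range (⌊w⌋₊ + 1)) fun k hk => ?_, ← sum_finrank_harmonicPoly hd,
    Nat.cast_sum]
  · refine Finset.sum_congr rfl fun k hk => ?_
    have hk' : e k ∈ Set.Iic z := (he k).2 (Finset.mem_range.1 hk)
    change (Set.Iic z).indicator g (e k) = _
    rw [Set.indicator_of_mem hk']
    simp only [g, e, laplaceMultiplicity_sphereEigenvalue hd]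
    simp
  · have hk' : e k ∉ Set.Iic z := fun h => hk (Finset.mem_range.2 ((he k).1 h))
    exact Set.indicator_of_notMem hk' _

lemma sphereCounting_of_neg (hd : 1 ≤ d) {z : ℝ} (hz : z < 0) : sphereCounting d z = 0 := by
  refine ENNReal.tsum_eq_zero.2 fun μ => ?_
  rw [laplaceMultiplicity_eq_zero fun k => ?_]
  · simp
  · have h1 : (1 : ℝ) ≤ d := by exact_mod_cast hd
    have h2 : (0 : ℝ) ≤ k := k.cast_nonneg
    have h3 : (μ : ℝ) ≤ z := μ.2
    nlinarith

end Multiplicity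

/-! ### Sphere areas, Weyl constants and binomials. -/

section Constants

open MeasureTheory Module Nat

lemma toSphere_real_univ {E : Type*} [NormedAddCommGroup E] [InnerProductSpace ℝ E]
    [FiniteDimensional ℝ E] [MeasurableSpace E] [BorelSpace E] {m : ℕ} (hm : finrank ℝ E = m + 1) :
    (volume : Measure E).toSphere.real Set.univ =
      (m + 1) * (√Real.pi ^ (m + 1) / Real.Gamma ((m + 1) / 2 + 1)) := by
  have : Nontrivial E := Module.nontrivial_of_finrank_pos (R := ℝ) (by omega)
  rw [Measure.toSphere_real_apply_univ, Measure.real, InnerProductSpace.volume_ball, hm,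
    ENNReal.ofReal_one, one_pow, one_mul, ENNReal.toReal_ofReal]
  · push_cast
    rfl
  · have : 0 < Real.Gamma (((m + 1 : ℕ) : ℝ) / 2 + 1) := Real.Gamma_pos_of_pos (by positivity)
    positivity

lemma semiclassicalConst_mul_area (m : ℕ) :
    semiclassicalConst 0 m * ((m + 1) * (√Real.pi ^ (m + 1) / Real.Gamma ((m + 1) / 2 + 1))) =
      2 / m ! := by
  have hπ : 0 < √Real.pi := Real.sqrt_pos.2 Real.pi_pos
  have h1 : (4 * Real.pi) ^ (-(m : ℝ) / 2) = ((2 * √Real.pi) ^ m)⁻¹ := by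
    rw [show 4 * Real.pi = (2 * √Real.pi) ^ (2 : ℝ) by
      rw [Real.rpow_two, mul_pow, Real.sq_sqrt Real.pi_pos.le]; norm_num, ← Real.rpow_mul
      (by positivity), mul_div_cancel₀ _ two_ne_zero, Real.rpow_neg (by positivity),
      Real.rpow_natCast]
  have h2 : Real.Gamma (((m : ℝ) + 1) / 2 + 1) = (m + 1) / 2 * Real.Gamma ((m + 1) / 2) :=
    Real.Gamma_add_one (by positivity)
  -- Legendre duplication at `(m+1)/2` merges the Gamma factors of the Weyl constant and of the area
  -- into `m!`.
  have h3 := Real.Gamma_mul_Gamma_add_half (((m : ℝ) + 1) / 2)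
  rw [mul_div_cancel₀ _ two_ne_zero, Real.Gamma_nat_eq_factorial,
    show (1 : ℝ) - (m + 1) = -(m : ℝ) by ring, Real.rpow_neg zero_le_two, Real.rpow_natCast,
    show ((m : ℝ) + 1) / 2 + 1 / 2 = 0 + 1 + m / 2 by ring] at h3
  have h4 : 0 < Real.Gamma (((m : ℝ) + 1) / 2) := Real.Gamma_pos_of_pos (by positivity)
  have h5 : 0 < Real.Gamma (0 + 1 + (m : ℝ) / 2) := Real.Gamma_pos_of_pos (by positivity)
  have h6 : (0 : ℝ) < m ! := by exact_mod_cast Nat.factorial_pos m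
  rw [semiclassicalConst, h1, h2, zero_add, Real.Gamma_one, mul_pow, pow_succ]
  rw [zero_add] at h3 h5
  field_simp at h3 ⊢
  linear_combination -h3

lemma semiclassicalConst_mul_sphereArea (d : ℕ) :
    semiclassicalConst 0 d * sphereArea d = 2 / d ! := by
  rw [sphereArea, toSphere_real_univ (finrank_euclideanSpace_fin), semiclassicalConst_mul_area]

lemma finrank_equatorialHyperplane (d : ℕ) : finrank ℝ (equatorialHyperplane d) = d := by
  have h := LinearMap.finrank_range_add_finrank_ker
    ((EuclideanSpace.proj (Fin.last d) : Ambient d →L[ℝ] ℝ) : Ambient d →ₗ[ℝ] ℝ)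
  have hs : LinearMap.range
      ((EuclideanSpace.proj (Fin.last d) : Ambient d →L[ℝ] ℝ) : Ambient d →ₗ[ℝ] ℝ) = ⊤ :=
    LinearMap.range_eq_top.2 fun c => ⟨EuclideanSpace.single (Fin.last d) c, by simp⟩
  rw [hs, finrank_top, finrank_self, finrank_euclideanSpace_fin] at h
  exact Nat.add_left_cancel (h.trans (add_comm d 1))

lemma semiclassicalConst_mul_hemisphereBoundaryArea (m : ℕ) :
    semiclassicalConst 0 m * hemisphereBoundaryArea (m + 1) = 2 / m ! := by
  rw [hemisphereBoundaryArea, frontier_hemisphere, Set.preimage_range,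
    toSphere_real_univ (finrank_equatorialHyperplane (m + 1)), semiclassicalConst_mul_area]

lemma semiclassicalConst_ratio (m : ℕ) :
    semiclassicalConst 0 m / semiclassicalConst 0 ((m + 1 : ℕ) : ℝ) *
      (hemisphereBoundaryArea (m + 1) / sphereArea (m + 1)) = m + 1 := by
  have h6 : (0 : ℝ) < m ! := by exact_mod_cast Nat.factorial_pos m
  rw [_root_.div_mul_div_comm, semiclassicalConst_mul_hemisphereBoundaryArea,
    semiclassicalConst_mul_sphereArea, Nat.factorial_succ]
  push_cast
  field_simp

/-- Both binomials share the factor `(K+1)⋯(K+n)`, with cofactors `K+n+1` and `K`. -/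
lemma factorial_mul_choose_add_choose (n K : ℕ) :
    (n + 1)! * ((n + 1 + K).choose (n + 1) + (n + 1 + K - 1).choose (n + 1)) =
      (2 * K + (n + 1)) * ∏ j ∈ Finset.range n, (K + 1 + j) := by
  have h1 : (n + 1)! * (n + 1 + K).choose (n + 1) = (K + 1 + n) * (K + 1).ascFactorial n := by
    rw [add_comm (n + 1) K, ← Nat.ascFactorial_eq_factorial_mul_choose, Nat.ascFactorial_succ]
  have h2 : (n + 1)! * (n + 1 + K - 1).choose (n + 1) = K * (K + 1).ascFactorial n := by
    cases K with
    | zero => simp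
    | succ K =>
      rw [show n + 1 + (K + 1) - 1 = K + (n + 1) by omega,
        ← Nat.ascFactorial_eq_factorial_mul_choose, Nat.ascFactorial_succ, Nat.succ_ascFactorial]
  rw [mul_add, h1, h2, Nat.ascFactorial_eq_prod_range]
  ring

end Constants

/-! ### Second-order expansions with bounded coefficients. -/

section Asymptotics

open Filter Asymptotics

variable {ι : Type*} {l : Filter ι} {t f g α β α' β' : ι → ℝ}

/-- `f = 1 + α t + β t² + O(t³)` with bounded coefficients `α` and `β`. -/
structure HasQuadraticExpansion (l : Filter ι) (t f α β : ι → ℝ) : Prop where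
  isBigO_sub : (fun z => f z - (1 + α z * t z + β z * t z ^ 2)) =O[l] fun z => t z ^ 3
  isBigO_fst : α =O[l] fun _ => (1 : ℝ)
  isBigO_snd : β =O[l] fun _ => (1 : ℝ)

lemma HasQuadraticExpansion.mul (ht : t =O[l] fun _ => (1 : ℝ))
    (hf : HasQuadraticExpansion l t f α β) (hg : HasQuadraticExpansion l t g α' β') :
    HasQuadraticExpansion l t (fun z => f z * g z) (fun z => α z + α' z)
      (fun z => β z + β' z + α z * α' z) := by
  have h3 : (fun z => t z ^ 3) =O[l] fun _ => (1 : ℝ) := by simpa using ht.pow 3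
  have h2 : (fun z => t z ^ 2) =O[l] fun _ => (1 : ℝ) := by simpa using ht.pow 2
  have hO {u v : ι → ℝ} (hu : u =O[l] fun _ => (1 : ℝ)) (hv : v =O[l] fun _ => (1 : ℝ)) :
      (fun z => u z * v z) =O[l] fun _ => (1 : ℝ) := by simpa using hu.mul hv
  have hp {a b : ι → ℝ} (ha : a =O[l] fun _ => (1 : ℝ)) (hb : b =O[l] fun _ => (1 : ℝ)) :
      (fun z => 1 + a z * t z + b z * t z ^ 2) =O[l] fun _ => (1 : ℝ) :=
    ((isBigO_refl _ _).add (hO ha ht)).add (hO hb h2)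
  have hg1 : g =O[l] fun _ => (1 : ℝ) := by
    simpa using (hg.isBigO_sub.trans h3).add (hp hg.isBigO_fst hg.isBigO_snd)
  refine ⟨?_, hf.isBigO_fst.add hg.isBigO_fst,
    (hf.isBigO_snd.add hg.isBigO_snd).add (hO hf.isBigO_fst hg.isBigO_fst)⟩
  have e1 : (fun z => (f z - (1 + α z * t z + β z * t z ^ 2)) * g z) =O[l] fun z => t z ^ 3 := by
    simpa using hf.isBigO_sub.mul hg1
  have e2 : (fun z => (1 + α z * t z + β z * t z ^ 2) *
      (g z - (1 + α' z * t z + β' z * t z ^ 2))) =O[l] fun z => t z ^ 3 := by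
    simpa using (hp hf.isBigO_fst hf.isBigO_snd).mul hg.isBigO_sub
  -- The terms of orders `t³` and `t⁴` in the product of the two quadratic polynomials.
  have e3 : (fun z => (α z * β' z + β z * α' z + β z * β' z * t z) * t z ^ 3) =O[l]
      fun z => t z ^ 3 := by
    simpa using (((hO hf.isBigO_fst hg.isBigO_snd).add (hO hf.isBigO_snd hg.isBigO_fst)).add
      (hO (hO hf.isBigO_snd hg.isBigO_snd) ht)).mul (isBigO_refl (fun z => t z ^ 3) l)
  refine ((e1.add e2).add e3).congr_left fun z => ?_
  ring

/-- Multiplying out, the second coefficient acquires `∑_{i<j} αᵢαⱼ`, written through power sums so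
that it can be evaluated in closed form. -/
lemma HasQuadraticExpansion.prod_range (ht : t =O[l] fun _ => (1 : ℝ)) {f α β : ℕ → ι → ℝ} (n : ℕ)
    (h : ∀ j < n, HasQuadraticExpansion l t (f j) (α j) (β j)) :
    HasQuadraticExpansion l t (fun z => ∏ j ∈ Finset.range n, f j z)
      (fun z => ∑ j ∈ Finset.range n, α j z)
      (fun z => ∑ j ∈ Finset.range n, β j z + ((∑ j ∈ Finset.range n, α j z) ^ 2 -
        ∑ j ∈ Finset.range n, α j z ^ 2) / 2) := by
  induction n with
  | zero =>
    exact ⟨(isBigO_zero (E' := ℝ) _ l).congr_left (by simp),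
      (isBigO_zero (E' := ℝ) _ l).congr_left (by simp),
      (isBigO_zero (E' := ℝ) _ l).congr_left (by simp)⟩
  | succ n ih =>
    have := (ih fun j hj => h j (by omega)).mul ht (h n n.lt_succ_self)
    simp only [Finset.prod_range_succ, Finset.sum_range_succ]
    convert! this using 1
    funext z
    ring

lemma sum_range_add_sq (n : ℕ) (c : ℝ) : ∑ j ∈ Finset.range n, (j + c) ^ 2 =
    n * c ^ 2 + c * n * (n - 1) + (n - 1) * n * (2 * n - 1) / 6 := by
  induction n with
  | zero => simp
  | succ n ih =>
    rw [Finset.sum_range_succ, ih]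
    push_cast
    ring

lemma sum_range_add (n : ℕ) (c : ℝ) : ∑ j ∈ Finset.range n, (j + c) = n * c + n * (n - 1) / 2 := by
  induction n with
  | zero => simp
  | succ n ih =>
    rw [Finset.sum_range_succ, ih]
    push_cast
    ring

end Asymptotics

/-! ### Expansion of the counting function. -/

section CountingAsymptotics

open Filter Asymptotics

lemma abs_fluctuation_le (η : ℝ) : |fluctuation η| ≤ 1 / 2 := by
  have h1 := Int.floor_le η
  have h2 := Int.lt_floor_add_one η
  rw [fluctuation, abs_le]
  constructor <;> linarith

lemma isBigO_fluctuation (w : ℝ → ℝ) :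
    (fun z => fluctuation (w z)) =O[atTop] fun _ => (1 : ℝ) :=
  IsBigO.of_bound (1 / 2) (Eventually.of_forall fun z => by simpa using abs_fluctuation_le (w z))

lemma isBigO_rpow_neg_half : (fun z : ℝ => z ^ (-(1 / 2) : ℝ)) =O[atTop] fun _ => (1 : ℝ) :=
  (tendsto_rpow_neg_atTop (by norm_num : (0 : ℝ) < 1 / 2)).isBigO_one ℝ

/-- With `m = (d-1)/2` and `t = z^{-1/2}`, completing the square gives `x² = 1 + m²t²` for `x =
(w+m)t`, so `x ≈ 1 + m²t²/2`. The rest is `⌊w⌋ = w - ψ(w) - 1/2`. -/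
lemma hasQuadraticExpansion_floor_add {d : ℕ} {w : ℝ → ℝ}
    (hw : ∀ z : ℝ, 0 ≤ z → 0 ≤ w z ∧ w z * (w z + d - 1) = z) (hd : 1 ≤ d) (a : ℝ) :
    HasQuadraticExpansion atTop (fun z => z ^ (-(1 / 2) : ℝ))
      (fun z => (⌊w z⌋₊ + a) * z ^ (-(1 / 2) : ℝ)) (fun z => a - d / 2 - fluctuation (w z))
      (fun _ => (d - 1 : ℝ) ^ 2 / 8) := by
  refine ⟨?_, (isBigO_const_const _ one_ne_zero _).sub (isBigO_fluctuation w),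
    isBigO_const_const _ one_ne_zero _⟩
  set m : ℝ := (d - 1) / 2 with hm
  have hm0 : 0 ≤ m := by
    have : (1 : ℝ) ≤ d := by exact_mod_cast hd
    rw [hm]
    linarith
  -- The error is exactly `-(x-1)²/2`, and `0 ≤ x-1 ≤ (x²-1)/2 = m²t²/2`; finally `t⁴ ≤ t³` since `t
  -- ≤ 1`.
  refine IsBigO.of_bound (m ^ 4 / 8) ?_
  filter_upwards [eventually_ge_atTop 1] with z hz
  obtain ⟨hw0, hwz⟩ := hw z (by linarith)
  set t := z ^ (-(1 / 2) : ℝ) with ht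
  have ht0 : 0 < t := Real.rpow_pos_of_pos (by linarith) _
  have ht1 : t ≤ 1 := Real.rpow_le_one_of_one_le_of_nonpos hz (by norm_num)
  have hzt : z * t ^ 2 = 1 := by
    rw [ht, ← Real.rpow_natCast, ← Real.rpow_mul (by linarith)]
    norm_num
    rw [Real.rpow_neg_one, mul_inv_cancel₀ (by linarith)]
  have hK : (⌊w z⌋₊ : ℝ) = w z - fluctuation (w z) - 1 / 2 := by
    rw [natCast_floor_eq_intCast_floor hw0, fluctuation]
    ring
  set x := (w z + m) * t with hx
  have hx0 : 0 ≤ x := by positivity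
  have hx2 : x ^ 2 = 1 + m ^ 2 * t ^ 2 := by
    rw [← hzt, ← hwz, hx, hm]
    ring
  have hx1 : 1 ≤ x := by nlinarith [mul_nonneg (sq_nonneg m) (sq_nonneg t)]
  have e : (⌊w z⌋₊ + a) * t - (1 + (a - d / 2 - fluctuation (w z)) * t +
      (d - 1 : ℝ) ^ 2 / 8 * t ^ 2) = -((x - 1) ^ 2 / 2) := by
    have : (d - 1 : ℝ) ^ 2 / 8 * t ^ 2 = (x ^ 2 - 1) / 2 := by
      rw [hx2, hm]
      ring
    rw [this, hK, hx, hm]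
    ring
  have h1 : x - 1 ≤ m ^ 2 * t ^ 2 / 2 := by nlinarith
  have h2 : (x - 1) ^ 2 ≤ (m ^ 2 * t ^ 2 / 2) ^ 2 := by gcongr
  have h3 : m ^ 4 * (t ^ 3 * t) ≤ m ^ 4 * (t ^ 3 * 1) := by gcongr
  rw [e, norm_neg, Real.norm_of_nonneg (by positivity), Real.norm_of_nonneg (by positivity)]
  nlinarith

/-- With `d = n+1`, the last factor is half of `2K+d`. The shifts `j+1-d/2` are symmetric about `0`,
so they cancel in the first-order term and each of the `d` factors contributes only `-ψ`. -/
lemma hasQuadraticExpansion_counting {n : ℕ} {w : ℝ → ℝ}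
    (hw : ∀ z : ℝ, 0 ≤ z → 0 ≤ w z ∧ w z * (w z + (n + 1 : ℕ) - 1) = z) :
    HasQuadraticExpansion atTop (fun z => z ^ (-(1 / 2) : ℝ))
      (fun z => (∏ j ∈ Finset.range n, (⌊w z⌋₊ + (j + 1 : ℝ)) * z ^ (-(1 / 2) : ℝ)) *
        ((⌊w z⌋₊ + (n + 1 : ℝ) / 2) * z ^ (-(1 / 2) : ℝ)))
      (fun z => -((n + 1) * fluctuation (w z)))
      (fun z => (n + 1) * n * (12 * fluctuation (w z) ^ 2 + 2 * (n + 1) - 1) / 24) := by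
  have h1 := HasQuadraticExpansion.prod_range isBigO_rpow_neg_half n fun j _ =>
    hasQuadraticExpansion_floor_add hw (by omega) (j + 1)
  have h2 := h1.mul isBigO_rpow_neg_half
    (hasQuadraticExpansion_floor_add hw (by omega) ((n + 1) / 2))
  have hs (ψ : ℝ) : ∑ j ∈ Finset.range n, ((j : ℝ) + 1 - (n + 1 : ℕ) / 2 - ψ) = -(n * ψ) := by
    have := sum_range_add n (1 - (n + 1 : ℕ) / 2 - ψ)
    simp only [add_sub_assoc] at this ⊢
    rw [this]
    push_cast
    ring
  have hs2 (ψ : ℝ) : ∑ j ∈ Finset.range n, ((j : ℝ) + 1 - (n + 1 : ℕ) / 2 - ψ) ^ 2 =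
      n * (1 - (n + 1) / 2 - ψ) ^ 2 + (1 - (n + 1) / 2 - ψ) * n * (n - 1) +
        (n - 1) * n * (2 * n - 1) / 6 := by
    rw [← sum_range_add_sq]
    push_cast
    refine Finset.sum_congr rfl fun j _ => ?_
    ring
  simp only [hs, hs2] at h2
  convert! h2 using 1
  · funext z
    push_cast
    ring
  · funext z
    simp only [Finset.sum_const, Finset.card_range, nsmul_eq_mul]
    push_cast
    ring

end CountingAsymptotics

theorem mainTheorem6 (d : ℕ) (hd : 2 ≤ d) (w : ℝ → ℝ)
    (hw : ∀ z : ℝ, 0 ≤ z → 0 ≤ w z ∧ w z * (w z + d - 1) = z) :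
    (∀ z : ℝ, sphereCounting d z ≠ ⊤) ∧
    (fun z : ℝ =>
        (sphereCounting d z).toReal / (semiclassicalConst 0 d * sphereArea d * z ^ ((d : ℝ) / 2))
        - (1
          - semiclassicalConst 0 ((d : ℝ) - 1) / semiclassicalConst 0 d
              * (hemisphereBoundaryArea d / sphereArea d)
              * fluctuation (w z) * z ^ (-(1 / 2) : ℝ)
          + (d : ℝ) * ((d : ℝ) - 1) * (12 * fluctuation (w z) ^ 2 + 2 * (d : ℝ) - 1) / 24
              * z ^ (-1 : ℝ)))
      =O[Filter.atTop] fun z : ℝ => z ^ (-(3 / 2) : ℝ) := by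
  refine ⟨fun z => ?_, ?_⟩
  -- Negative `z` is separate because `w` is constrained only for `z ≥ 0`.
  · rcases lt_or_ge z 0 with hz | hz
    · simp [sphereCounting_of_neg (by omega : 1 ≤ d) hz]
    · rw [sphereCounting_eq (by omega) (hw z hz).1 (hw z hz).2]
      exact ENNReal.natCast_ne_top _
  obtain ⟨n, rfl⟩ := Nat.exists_eq_add_of_le' (by omega : 1 ≤ d)
  have hpow (z : ℝ) (hz : 0 < z) (k : ℕ) :
      (z ^ (-(1 / 2) : ℝ)) ^ k = z ^ (-((k : ℝ) / 2)) := by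
    rw [← Real.rpow_natCast, ← Real.rpow_mul hz.le]
    ring_nf
  refine (hasQuadraticExpansion_counting hw).isBigO_sub.congr' ?_ ?_
  · filter_upwards [Filter.eventually_gt_atTop 0] with z hz
    obtain ⟨hw0, hwz⟩ := hw z hz.le
    have h1 : ((n + 1 : ℕ) : ℝ) - 1 = n := by push_cast; ring
    have hf : (0 : ℝ) < (n + 1).factorial := by exact_mod_cast Nat.factorial_pos _
    have h2 := congrArg (Nat.cast (R := ℝ)) (factorial_mul_choose_add_choose n ⌊w z⌋₊)
    have h3 : z ^ (((n + 1 : ℕ) : ℝ) / 2) * (z ^ (-(1 / 2) : ℝ)) ^ (n + 1) = 1 := by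
      rw [hpow z hz, ← Real.rpow_add hz, add_neg_cancel, Real.rpow_zero]
    have hz' : 0 < z ^ (((n + 1 : ℕ) : ℝ) / 2) := Real.rpow_pos_of_pos hz _
    have h4 : z ^ (-1 : ℝ) = (z ^ (-(1 / 2) : ℝ)) ^ 2 := by
      rw [hpow z hz]
      norm_num
    rw [h1, sphereCounting_eq (by omega) hw0 hwz, semiclassicalConst_ratio,
      semiclassicalConst_mul_sphereArea, ENNReal.toReal_natCast, h4, Finset.prod_mul_distrib,
      Finset.prod_const, Finset.card_range]
    -- Each of the `d = n+1` linear factors in `⌊w⌋` absorbs one `z^{-1/2}` of `z^{-d/2}`.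
    have h5 : (((n + 1 + ⌊w z⌋₊).choose (n + 1) + (n + 1 + ⌊w z⌋₊ - 1).choose (n + 1) : ℕ) : ℝ) /
        (2 / (n + 1).factorial * z ^ (((n + 1 : ℕ) : ℝ) / 2)) =
        (∏ j ∈ Finset.range n, (⌊w z⌋₊ + (j + 1 : ℝ))) * (z ^ (-(1 / 2) : ℝ)) ^ n *
          ((⌊w z⌋₊ + (n + 1 : ℝ) / 2) * z ^ (-(1 / 2) : ℝ)) := by
      have h6 : ∏ j ∈ Finset.range n, ((⌊w z⌋₊ : ℝ) + (j + 1)) =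
          ∏ j ∈ Finset.range n, ((⌊w z⌋₊ : ℝ) + 1 + j) :=
        Finset.prod_congr rfl fun j _ => by ring
      rw [div_eq_iff (by positivity), h6]
      push_cast at h2 ⊢
      push_cast at h3
      set P := ∏ j ∈ Finset.range n, ((⌊w z⌋₊ : ℝ) + 1 + j)
      refine mul_left_cancel₀ hf.ne' (h2.trans ?_)
      have h7 : ((n + 1).factorial : ℝ) * (2 / (n + 1).factorial) = 2 :=
        mul_div_cancel₀ _ hf.ne'
      set T := z ^ (-(1 / 2) : ℝ)
      set Z := z ^ (((n : ℝ) + 1) / 2)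
      linear_combination (-(2 * ⌊w z⌋₊ + (n + 1)) * P) * h3 -
        (P * T ^ n * ((⌊w z⌋₊ + (n + 1) / 2) * T) * Z) * h7
    rw [h5]
    push_cast
    ring
  · filter_upwards [Filter.eventually_gt_atTop 0] with z hz
    rw [hpow z hz]
    norm_num
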